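/- **Quantum Young's inequality.** Let $M$ be a von Neumann algebra acting on a Hilbert space, with a faithful normal tracial positive linear functional $\tau$. For $x\in M$ put $\|x\|_p=\tau(|x|^p)^{1/p}$ for $1\le p<\infty$, and let $\|x\|_\infty=\|x\|$ be the operator norm; let $L^1(M)$ be the completion of $M$ in $\|\cdot\|_1$, with its positive cone $\{h:\tau(hz)\ge 0 \text{ for all } z\ge 0 \text{ in } M\}$. Let $k>0$, and let $*: M\times M\to L^1(M)$ be a good $k$-convolution, that is, a bilinear map such that 1. $x*y\ge 0$ for all $x,y\ge 0$ in $M$; 2. $\|x*y\|_1\le k\|x\|_1\|y\|_1$ for all $x,y\in M$; 3. $\tau(x*y)=k\,\tau(x)\tau(y)$ for all $x,y\in M$. Let $\rho$ be an antipode, that is, a $\tau$-preserving anti-$*$-isomorphism of $M$ onto itself such that $$\tau\big((x*y)z\big)=\tau\big((\rho(z)*x)\rho(y)\big)\qquad\text{for all }x,y,z\in M.$$ (Then $(M,\tau,*,\rho)$ is called a Frobenius von Neumann $k$-algebra.) Let $1\le p,q,r\le\infty$ with $1+\frac1r=\frac1p+\frac1q$, where $\frac1\infty=0$. Then for all $x,y\in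 M$ the element $x*y$ belongs to $M$ and $$\|x*y\|_r\le k\,\|x\|_p\,\|y\|_q .$$ -/

import Mathlib

open scoped ENNReal InnerProductSpace ComplexOrder

/-! ### The C⋆-algebra structure of a concrete von Neumann algebra -/

section CStar

variable {H : Type*} [NormedAddCommGroup H] [InnerProductSpace ℂ H] [CompleteSpace H]

instance VonNeumannAlgebra.instSMulMemClassComplex :
    SMulMemClass (VonNeumannAlgebra H) ℂ (H →L[ℂ] H) where
  smul_mem {S} r _ hx := S.toStarSubalgebra.smul_mem hx r

theorem VonNeumannAlgebra.isClosed_coe (M : VonNeumannAlgebra H) :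
    IsClosed (M : Set (H →L[ℂ] H)) := by
  rw [← M.centralizer_centralizer]
  exact Set.isClosed_centralizer _

/-- The operations and the (operator) norm are those inherited from the bounded operators. -/
noncomputable instance VonNeumannAlgebra.instCStarAlgebra (M : VonNeumannAlgebra H) :
    CStarAlgebra M :=
  StarSubalgebra.cstarAlgebra M (h_closed := M.isClosed_coe)

end CStar

namespace FrobeniusVN

section Lp

variable {A : Type*} [CStarAlgebra A]

/-- `τ` is a faithful tracial positive linear functional. -/
structure IsFaithfulTrace (τ : StrongDual ℂ A) : Prop where
  nonneg : ∀ x : A, 0 ≤ τ (star x * x)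
  tracial : ∀ x y : A, τ (x * y) = τ (y * x)
  faithful : ∀ x : A, τ (star x * x) = 0 → x = 0

/-- `|x| ^ s = (x⋆ x) ^ (s / 2)` for `s > 0`, by continuous functional calculus. -/
noncomputable def absPow (x : A) (s : ℝ) : A :=
  cfc (fun t : ℝ => t ^ (s / 2)) (star x * x)

/-- The noncommutative `p`-norm of a bounded element `x` for `1 ≤ p ≤ ∞`:
`‖x‖_p = τ(|x|^p)^{1/p}` for finite `p`, and the operator norm for `p = ∞`. -/
noncomputable def pNorm (τ : StrongDual ℂ A) (p : ℝ≥0∞) (x : A) : ℝ :=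
  if p = ∞ then ‖x‖ else (τ (absPow x p.toReal)).re ^ (1 / p.toReal)

/-- The linear map `a ↦ τ(a ·)` from the algebra into its Banach space dual. -/
noncomputable def toDual (τ : StrongDual ℂ A) : A →L[ℂ] StrongDual ℂ A :=
  (ContinuousLinearMap.compL ℂ A A ℂ τ) ∘L (ContinuousLinearMap.mul ℂ A)

/-- The space `L¹(A, τ)`: the completion of `A` for the norm `‖a‖₁ = τ(|a|)`, realized inside the
dual of `A`: an element `h` of `L¹` is the functional `z ↦ τ(h z)`, and its norm `‖h‖₁` is the
norm of this functional, which for `a ∈ A` is `τ(|a|)` by `norm_toL1` below. When `A` is a von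
Neumann algebra and `τ` is normal, this is its predual. -/
noncomputable def L1 (τ : StrongDual ℂ A) : Submodule ℂ (StrongDual ℂ A) :=
  (LinearMap.range (toDual τ).toLinearMap).topologicalClosure

/-- The inclusion of bounded elements into `L¹`. -/
noncomputable def toL1 (τ : StrongDual ℂ A) : A →ₗ[ℂ] L1 τ :=
  (toDual τ).toLinearMap.codRestrict (L1 τ)
    fun a => Submodule.le_topologicalClosure _ (LinearMap.mem_range_self _ a)

/-- The number `τ(h z)`, for `h ∈ L¹` and `z` bounded. -/
noncomputable def traceMul (τ : StrongDual ℂ A) (h : L1 τ) (z : A) : ℂ :=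
  (h : StrongDual ℂ A) z

theorem traceMul_toL1 (τ : StrongDual ℂ A) (a z : A) : traceMul τ (toL1 τ a) z = τ (a * z) := rfl

theorem toL1_injective {τ : StrongDual ℂ A} (hτ : IsFaithfulTrace τ) :
    Function.Injective (toL1 τ) := by
  rw [injective_iff_map_eq_zero]
  intro a ha
  refine hτ.faithful a ?_
  rw [hτ.tracial, ← traceMul_toL1, ha]
  rfl

theorem IsFaithfulTrace.re_star {τ : StrongDual ℂ A} (hτ : IsFaithfulTrace τ) (u : A) :
    (τ (star u)).re = (τ u).re := by
  have h1 := (Complex.nonneg_iff.1 (hτ.nonneg 1)).2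
  have h2 := (Complex.nonneg_iff.1 (hτ.nonneg u)).2
  have h3 := (Complex.nonneg_iff.1 (hτ.nonneg (1 + Complex.I • u))).2
  have e : star (1 + Complex.I • u) * (1 + Complex.I • u)
      = star 1 * 1 + Complex.I • u - Complex.I • star u + star u * u := by
    simp only [star_add, star_one, star_smul, Complex.star_def, Complex.conj_I, add_mul, mul_add,
      one_mul, mul_one, smul_mul_smul_comm, neg_smul, neg_mul, Complex.I_mul_I, neg_neg, one_smul]
    abel
  rw [e] at h3
  simp at h1 h2 h3
  linarith

theorem IsFaithfulTrace.re_nonneg {τ : StrongDual ℂ A} (hτ : IsFaithfulTrace τ) {b : A} {f : ℝ → ℝ}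
    (hf : ContinuousOn f (spectrum ℝ b)) (h : ∀ t ∈ spectrum ℝ b, 0 ≤ f t) :
    0 ≤ (τ (cfc f b)).re := by
  have hs : ContinuousOn (fun t => √(f t)) (spectrum ℝ b) := hf.sqrt
  have e : cfc f b = star (cfc (fun t => √(f t)) b) * cfc (fun t => √(f t)) b := by
    rw [(IsSelfAdjoint.cfc (f := fun t => √(f t)) (a := b)).star_eq, ← cfc_mul _ _ b hs hs]
    exact cfc_congr fun t ht => (Real.mul_self_sqrt (h t ht)).symm
  rw [e]
  exact (Complex.nonneg_iff.1 (hτ.nonneg _)).1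

theorem IsFaithfulTrace.re_mono {τ : StrongDual ℂ A} (hτ : IsFaithfulTrace τ) {b : A} {f g : ℝ → ℝ}
    (hf : ContinuousOn f (spectrum ℝ b)) (hg : ContinuousOn g (spectrum ℝ b))
    (h : ∀ t ∈ spectrum ℝ b, f t ≤ g t) : (τ (cfc f b)).re ≤ (τ (cfc g b)).re := by
  have := hτ.re_nonneg (b := b) (f := fun t => g t - f t) (hg.sub hf) fun t ht => sub_nonneg.2 (h t ht)
  rw [cfc_sub _ _ b hg hf] at this
  simp at this
  linarith

theorem IsFaithfulTrace.re_conj_le {τ : StrongDual ℂ A} (hτ : IsFaithfulTrace τ) (v h : A)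
    (hv : ‖v‖ ≤ 1) : (τ (star (v * h) * (v * h))).re ≤ (τ (star h * h)).re := by
  have hsa : IsSelfAdjoint (star v * v) := IsSelfAdjoint.star_mul_self v
  have hle : ∀ t ∈ spectrum ℝ (star v * v), 0 ≤ 1 - t := by
    intro t ht
    have h1 : |t| ≤ ‖star v * v‖ := by
      have h2 := norm_apply_le_norm_cfc (fun t : ℝ => t) (star v * v) ht
      rwa [cfc_id' ℝ (star v * v), Real.norm_eq_abs] at h2
    rw [CStarRing.norm_star_mul_self] at h1
    nlinarith [le_abs_self t, norm_nonneg v]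
  have hc : ContinuousOn (fun t : ℝ => √(1 - t)) (spectrum ℝ (star v * v)) := by fun_prop
  set s := cfc (fun t : ℝ => √(1 - t)) (star v * v) with hs
  have e : star s * s = 1 - star v * v := by
    rw [hs, (IsSelfAdjoint.cfc (f := fun t : ℝ => √(1 - t)) (a := star v * v)).star_eq,
      ← cfc_mul _ _ _ hc hc,
      cfc_congr (g := fun t : ℝ => 1 - t) fun t ht => Real.mul_self_sqrt (hle t ht),
      cfc_sub (fun _ => 1) (fun t => t), cfc_const_one ℝ (star v * v), cfc_id' ℝ (star v * v)]
  have h3 := (Complex.nonneg_iff.1 (hτ.nonneg (s * h))).1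
  have e2 : star (s * h) * (s * h) = star h * h - star (v * h) * (v * h) := by
    calc star (s * h) * (s * h) = star h * (star s * s) * h := by simp [mul_assoc]
      _ = _ := by rw [e]; simp [mul_assoc, mul_sub, sub_mul]
  rw [e2] at h3
  simp at h3 ⊢
  linarith

/-- The norm of `L¹` extends the `1`-norm of bounded elements. -/
theorem norm_toL1 {τ : StrongDual ℂ A} (hτ : IsFaithfulTrace τ) (a : A) :
    ‖toL1 τ a‖ = pNorm τ 1 a := by
  set b := star a * a with hb
  have hsa : IsSelfAdjoint b := IsSelfAdjoint.star_mul_self a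
  have hpos : ∀ t ∈ spectrum ℝ b, 0 ≤ t := by
    let _ := CStarAlgebra.spectralOrder A
    have _ := CStarAlgebra.spectralOrderedRing A
    exact fun t ht => spectrum_nonneg_of_nonneg (star_mul_self_nonneg a) ht
  have hp : pNorm τ 1 a = (τ (cfc (fun t : ℝ => √t) b)).re := by
    simp [pNorm, absPow, Real.sqrt_eq_rpow, hb]
  have hn : ‖toL1 τ a‖ = ‖toDual τ a‖ := rfl
  have hap : ∀ z, toDual τ a z = τ (a * z) := fun z => rfl
  set T := (τ (1 : A)).re with hT
  have hT0 : 0 ≤ T := by simpa using (Complex.nonneg_iff.1 (hτ.nonneg 1)).1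
  have hτc : ∀ c : ℝ, (τ (cfc (fun _ : ℝ => c) b)).re = c * T := by
    intro c
    rw [cfc_const c b, Algebra.algebraMap_eq_smul_one, ← Complex.coe_smul, map_smul]
    simp [hT]
  have c1 : ContinuousOn (fun t : ℝ => √t) (spectrum ℝ b) := by fun_prop
  rw [hn, hp]
  set N := (τ (cfc (fun t : ℝ => √t) b)).re with hN
  have key : ∀ ε : ℝ, 0 < ε → ∃ w g h : A, a = w * (h * h) ∧ ‖w‖ ≤ 1 ∧ star h = h ∧
      (τ (star h * h)).re = N + ε * T ∧ w = a * g ∧ star g = g ∧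
      N - ε * T ≤ (τ (g * (star a * a))).re := by
    intro ε hε
    have hne : ∀ t : ℝ, √t + ε ≠ 0 := fun t => by positivity
    have cg : ContinuousOn (fun t : ℝ => (√t + ε)⁻¹) (spectrum ℝ b) :=
      ContinuousOn.inv₀ (by fun_prop) fun t _ => hne t
    have ch : ContinuousOn (fun t : ℝ => √(√t + ε)) (spectrum ℝ b) := by fun_prop
    have ci : ContinuousOn (fun t : ℝ => t) (spectrum ℝ b) := by fun_prop
    have sg : star (cfc (fun t : ℝ => (√t + ε)⁻¹) b) = cfc (fun t : ℝ => (√t + ε)⁻¹) b :=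
      (IsSelfAdjoint.cfc (f := fun t : ℝ => (√t + ε)⁻¹) (a := b)).star_eq
    have sh : star (cfc (fun t : ℝ => √(√t + ε)) b) = cfc (fun t : ℝ => √(√t + ε)) b :=
      (IsSelfAdjoint.cfc (f := fun t : ℝ => √(√t + ε)) (a := b)).star_eq
    have hh : cfc (fun t : ℝ => √(√t + ε)) b * cfc (fun t : ℝ => √(√t + ε)) b
        = cfc (fun t : ℝ => √t + ε) b := by
      rw [← cfc_mul _ _ b ch ch]
      exact cfc_congr fun t _ => Real.mul_self_sqrt (by positivity)
    refine ⟨a * cfc (fun t : ℝ => (√t + ε)⁻¹) b, cfc (fun t : ℝ => (√t + ε)⁻¹) b,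
      cfc (fun t : ℝ => √(√t + ε)) b, ?_, ?_, sh, ?_, rfl, sg, ?_⟩
    · rw [hh, mul_assoc, ← cfc_mul _ _ b cg (by fun_prop),
        cfc_congr (g := fun _ : ℝ => 1) fun t _ => inv_mul_cancel₀ (hne t), cfc_const_one ℝ b,
        mul_one]
    · have e : star (a * cfc (fun t : ℝ => (√t + ε)⁻¹) b) * (a * cfc (fun t : ℝ => (√t + ε)⁻¹) b)
          = cfc (fun t : ℝ => (√t + ε)⁻¹ * t * (√t + ε)⁻¹) b := by
        rw [cfc_mul (fun t : ℝ => (√t + ε)⁻¹ * t) _ b (cg.mul ci) cg, cfc_mul _ _ b cg ci, cfc_id' ℝ b, star_mul, sg, hb]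
        simp only [mul_assoc]
      have h1 : ‖a * cfc (fun t : ℝ => (√t + ε)⁻¹) b‖ * ‖a * cfc (fun t : ℝ => (√t + ε)⁻¹) b‖ ≤ 1 := by
        rw [← CStarRing.norm_star_mul_self, e]
        refine norm_cfc_le zero_le_one fun t ht => ?_
        have h0 := hpos t ht
        rw [Real.norm_of_nonneg (by positivity)]
        have h2 : √t * √t = t := Real.mul_self_sqrt h0
        have h3 : (√t + ε)⁻¹ * t * (√t + ε)⁻¹ = t / ((√t + ε) * (√t + ε)) := by
          field_simp
        rw [h3, div_le_one (by positivity)]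
        nlinarith [Real.sqrt_nonneg t]
      nlinarith [norm_nonneg (a * cfc (fun t : ℝ => (√t + ε)⁻¹) b)]
    · rw [sh, hh, cfc_add b (fun t : ℝ => √t) (fun _ => ε) c1 (by fun_prop), map_add, Complex.add_re,
        hτc]
    · have e : cfc (fun t : ℝ => (√t + ε)⁻¹) b * b = cfc (fun t : ℝ => (√t + ε)⁻¹ * t) b := by
        rw [cfc_mul _ _ b cg ci, cfc_id' ℝ b]
      rw [← hb, e]
      have h1 : N - ε * T = (τ (cfc (fun t : ℝ => √t - ε) b)).re := by
        rw [cfc_sub (fun t : ℝ => √t) (fun _ => ε) b c1 (by fun_prop), map_sub, Complex.sub_re,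
          hτc]
      rw [h1]
      refine hτ.re_mono (by fun_prop) (cg.mul ci) fun t ht => ?_
      have h2 : √t * √t = t := Real.mul_self_sqrt (hpos t ht)
      rw [inv_mul_eq_div, le_div_iff₀ (by positivity)]
      nlinarith
  have lim : ∀ x y : ℝ, (∀ ε : ℝ, 0 < ε → x ≤ y + ε * T) → x ≤ y := by
    intro x y h
    refine le_of_forall_pos_le_add fun δ hδ => (h (δ / (T + 1)) (by positivity)).trans ?_
    have : δ / (T + 1) * T ≤ δ := by
      rw [div_mul_eq_mul_div, div_le_iff₀ (by positivity)]
      nlinarith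
    linarith
  apply le_antisymm
  · refine lim _ _ fun ε hε => ?_
    obtain ⟨w, g, h, ha, hw, hh, hNe, -⟩ := key ε hε
    have hre : ∀ z : A, ‖z‖ ≤ 1 → (τ (a * z)).re ≤ N + ε * T := by
      intro z hz
      have hzw : ‖z * w‖ ≤ 1 := (norm_mul_le _ _).trans (mul_le_one₀ hz (norm_nonneg _) hw)
      have h1 := hτ.re_conj_le (z * w) h hzw
      set x := z * w * h with hx
      have h2 : τ (a * z) = τ (star h * x) := by
        rw [hh, hx, ha, hτ.tracial, hτ.tracial h]
        simp only [mul_assoc]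
      have h3 := (Complex.nonneg_iff.1 (hτ.nonneg (h - x))).1
      have h4 : (τ (star x * h)).re = (τ (star h * x)).re := by
        rw [← hτ.re_star]; simp
      simp only [star_sub, sub_mul, mul_sub, map_sub, Complex.sub_re] at h3
      rw [h2, ← hNe]
      linarith
    have hNn : 0 ≤ N + ε * T := by simpa using hre 0 (by simp)
    refine ContinuousLinearMap.opNorm_le_bound _ hNn fun z => ?_
    rw [hap]
    rcases eq_or_ne z 0 with rfl | hz
    · simp
    have hz' : 0 < ‖z‖ := norm_pos_iff.2 hz
    obtain ⟨c, hc, hcz⟩ := Complex.exists_norm_eq_mul_self (τ (a * z))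
    have h1 := hre (((‖z‖⁻¹ : ℝ) : ℂ) • c • z)
      (by rw [norm_smul, norm_smul, hc]; simp [hz'.ne'])
    have h2 : τ (a * (((‖z‖⁻¹ : ℝ) : ℂ) • c • z)) = ((‖z‖⁻¹ * ‖τ (a * z)‖ : ℝ) : ℂ) := by
      rw [mul_smul_comm, mul_smul_comm, map_smul, map_smul, smul_eq_mul, smul_eq_mul, ← hcz]
      push_cast
      rfl
    rw [h2, Complex.ofReal_re, inv_mul_le_iff₀ hz'] at h1
    linarith
  · refine lim _ _ fun ε hε => ?_
    obtain ⟨w, g, h, -, hw, -, -, hwg, hg, hle⟩ := key ε hε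
    have h1 : ‖g * star a‖ ≤ 1 := by
      rw [← norm_star, star_mul, star_star, hg, ← hwg]
      exact hw
    have h2 := (toDual τ a).le_opNorm (g * star a)
    rw [hap, hτ.tracial, mul_assoc] at h2
    have h3 := Complex.re_le_norm (τ (g * (star a * a)))
    have h4 : ‖toDual τ a‖ * ‖g * star a‖ ≤ ‖toDual τ a‖ :=
      mul_le_of_le_one_right (norm_nonneg _) h1
    linarith

/-- A good `k`-convolution: a bilinear map `∗` of bounded elements with values in `L¹` which is
positive, satisfies the primary Young inequality, and satisfies the Haar measure property
`τ(x ∗ y) = k τ(x) τ(y)`. (An element `h` of `L¹` is positive when `τ(h z) ≥ 0` for all `z ≥ 0`.)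
It need be neither associative nor commutative. -/
structure IsGoodConvolution (τ : StrongDual ℂ A) (k : ℝ) (conv : A →ₗ[ℂ] A →ₗ[ℂ] L1 τ) :
    Prop where
  pos : 0 < k
  nonneg : ∀ x y z : A, 0 ≤ traceMul τ (conv (star x * x) (star y * y)) (star z * z)
  primary_young : ∀ x y : A, ‖conv x y‖ ≤ k * pNorm τ 1 x * pNorm τ 1 y
  haar : ∀ x y : A, traceMul τ (conv x y) 1 = k * τ x * τ y

/-- An antipode: a trace-preserving anti-`⋆`-isomorphism `ρ` (written as a `⋆`-isomorphism onto the
opposite algebra) with the Frobenius reciprocity `τ((x ∗ y) z) = τ((ρ(z) ∗ x) ρ(y))`. -/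
structure IsAntipode (τ : StrongDual ℂ A) (conv : A →ₗ[ℂ] A →ₗ[ℂ] L1 τ) (ρ : A ≃⋆ₐ[ℂ] Aᵐᵒᵖ) :
    Prop where
  trace_preserving : ∀ x : A, τ (ρ x).unop = τ x
  frobenius : ∀ x y z : A,
    traceMul τ (conv x y) z = traceMul τ (conv (ρ z).unop x) (ρ y).unop

end Lp

section VonNeumann

variable {H : Type*} [NormedAddCommGroup H] [InnerProductSpace ℂ H] [CompleteSpace H]

/-- Normality (ultraweak, i.e. `σ`-weak, continuity) of a linear functional on a von Neumann algebra
acting on `H`: it is `∑ₙ ⟨ξₙ, · ηₙ⟩` for two square-summable sequences of vectors. -/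
def IsNormal (M : VonNeumannAlgebra H) (τ : StrongDual ℂ M) : Prop :=
  ∃ ξ η : ℕ → H, Summable (fun n => ‖ξ n‖ ^ 2) ∧ Summable (fun n => ‖η n‖ ^ 2) ∧
    ∀ x : M, HasSum (fun n => ⟪ξ n, (x : H →L[ℂ] H) (η n)⟫_ℂ) (τ x)

/-- `(M, τ, ∗, ρ)` is a Frobenius von Neumann `k`-algebra: `M` is a von Neumann algebra with a
faithful normal tracial positive linear functional `τ`, a good `k`-convolution and an antipode. -/
structure IsFrobeniusVNAlgebra (M : VonNeumannAlgebra H) (τ : StrongDual ℂ M) (k : ℝ)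
    (conv : M →ₗ[ℂ] M →ₗ[ℂ] L1 τ) (ρ : M ≃⋆ₐ[ℂ] (M)ᵐᵒᵖ) : Prop where
  trace : IsFaithfulTrace τ
  normal : IsNormal M τ
  convolution : IsGoodConvolution τ k conv
  antipode : IsAntipode τ conv ρ

end VonNeumann

end FrobeniusVN

/-! The proof interpolates the trilinear form `T(x, y, z) = τ((x ∗ y) z)` between three estimates.
By the primary Young inequality, `|T(x, y, z)| ≤ k ‖x‖₁ ‖y‖₁ ‖z‖∞`; Frobenius reciprocity permutes
the three arguments cyclically, and the antipode preserves the `1`-norm and the operator norm, so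
the factor `‖·‖∞` may be put on any one of the three arguments. Complex interpolation between these
three vertices gives, for `1/p + 1/q + 1/r' = 2`,
`|T(x, y, z)| ≤ k ‖x‖_p ‖y‖_q ‖z‖_{r'}` (`norm_trilinear_le`, `norm_traceMul_conv_le`).

Noncommutative `L^p` spaces are avoided: the interpolation runs along analytic families
`s ↦ v exp(s a) w` with `v`, `w` contractions, `a` self-adjoint and `τ(exp a) ≤ 1`, which are
contractive in the operator norm on `re s = 0` and in the `1`-norm on `re s = 1`. A regularized
polar decomposition (`exists_regularized_polar`), obtained by continuous functional calculus, shows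
that every `x` is a multiple, by a number arbitrarily close to `‖x‖_p`, of the value of such a
family at `s = 1/p` (`exists_analyticFamily`), and that testing against such families at
`s = 1 - 1/r` computes `‖·‖_r` (`pNorm_le_of_analyticFamily`).

That `x ∗ y` is bounded is the duality `(L¹)* = M` (`exists_toDual_eq`): for `p`, `q` conjugate the
functional `z ↦ τ((x ∗ y) z)` is dominated by a multiple of `‖z‖₁`. Here normality of `τ` and the
weak compactness of the unit ball of `M` enter, through a Hahn–Banach argument. -/

namespace FrobeniusVN

open Filter Topology

/-! ### Duality between `L¹` and the von Neumann algebra -/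

theorem toDual_apply {A : Type*} [CStarAlgebra A] (τ : StrongDual ℂ A) (a z : A) :
    toDual τ a z = τ (a * z) := rfl

section WeakLimit

variable {H : Type*} [NormedAddCommGroup H] [InnerProductSpace ℂ H] [CompleteSpace H]

/-- Weak-operator compactness of the balls of a von Neumann algebra, in terms of ultrafilters. The
limits of the matrix coefficients form a bounded sesquilinear form; the operator it defines still
commutes with the commutant, hence lies in `M`. -/
theorem exists_weak_limit (M : VonNeumannAlgebra H) {ι : Type*} (u : Ultrafilter ι) {C : ℝ}
    (hC : 0 ≤ C) (c : ι → M) (hc : ∀ᶠ i in (u : Filter ι), ‖c i‖ ≤ C) :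
    ∃ d : M, ‖d‖ ≤ C ∧ ∀ ξ η : H, Tendsto (fun i => ⟪ξ, (c i : H →L[ℂ] H) η⟫_ℂ) u
      (𝓝 ⟪ξ, (d : H →L[ℂ] H) η⟫_ℂ) := by
  have hb : ∀ ξ η : H, ∀ᶠ i in (u : Filter ι),
      ‖⟪(c i : H →L[ℂ] H) ξ, η⟫_ℂ‖ ≤ C * ‖ξ‖ * ‖η‖ := fun ξ η => by
    filter_upwards [hc] with i hi
    refine (norm_inner_le_norm _ _).trans ?_
    have : ‖(c i : H →L[ℂ] H) ξ‖ ≤ C * ‖ξ‖ :=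
      (ContinuousLinearMap.le_opNorm _ _).trans (by gcongr; exact hi)
    gcongr
  have hl : ∀ ξ η : H, ∃ l : ℂ, ‖l‖ ≤ C * ‖ξ‖ * ‖η‖ ∧
      Tendsto (fun i => ⟪(c i : H →L[ℂ] H) ξ, η⟫_ℂ) u (𝓝 l) := fun ξ η => by
    obtain ⟨l, hl, hlim⟩ := (isCompact_closedBall (0 : ℂ) (C * ‖ξ‖ * ‖η‖)).ultrafilter_le_nhds
      (u.map fun i => ⟪(c i : H →L[ℂ] H) ξ, η⟫_ℂ) (by
        simp only [Ultrafilter.coe_map, le_principal_iff, mem_map]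
        filter_upwards [hb ξ η] with i hi
        simpa using hi)
    exact ⟨l, by simpa using hl, hlim⟩
  choose l hln hl using hl
  let B : H →L⋆[ℂ] H →L[ℂ] ℂ := LinearMap.mkContinuous₂
    (LinearMap.mk₂'ₛₗ (starRingEnd ℂ) (RingHom.id ℂ) l
      (fun a b η => tendsto_nhds_unique (hl _ _) (by
        simpa [inner_add_left] using (hl a η).add (hl b η)))
      (fun z a η => tendsto_nhds_unique (hl _ _) (by
        simpa [inner_smul_left, mul_comm] using (hl a η).const_mul (starRingEnd ℂ z)))
      (fun a b η => tendsto_nhds_unique (hl _ _) (by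
        simpa [inner_add_right] using (hl a b).add (hl a η)))
      (fun z a η => tendsto_nhds_unique (hl _ _) (by
        simpa [inner_smul_right] using (hl a η).const_mul _))) C hln
  set d : H →L[ℂ] H := InnerProductSpace.continuousLinearMapOfBilin B with hd
  have hdB : ∀ ξ η, ⟪d ξ, η⟫_ℂ = l ξ η := fun ξ η =>
    InnerProductSpace.continuousLinearMapOfBilin_apply B ξ η
  have hlim : ∀ ξ η : H, Tendsto (fun i => ⟪ξ, (c i : H →L[ℂ] H) η⟫_ℂ) u (𝓝 ⟪ξ, d η⟫_ℂ) := by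
    intro ξ η
    have := (hl η ξ).star
    rw [← hdB] at this
    simpa using this
  have hmem : d ∈ M := by
    rw [← M.commutant_commutant, VonNeumannAlgebra.mem_commutant_iff]
    intro t ht
    have ht' : star t ∈ M.commutant := star_mem ht
    rw [VonNeumannAlgebra.mem_commutant_iff] at ht
    ext η
    refine ext_inner_left ℂ fun ξ => ?_
    refine tendsto_nhds_unique (f := fun i => ⟪ξ, (c i : H →L[ℂ] H) (t η)⟫_ℂ) ?_ (hlim ξ (t η))
    have h1 := hlim (ContinuousLinearMap.adjoint t ξ) η
    simp only [ContinuousLinearMap.adjoint_inner_left] at h1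
    refine h1.congr fun i => ?_
    have := congrArg (fun T : H →L[ℂ] H => T η) (ht _ (c i).2)
    simp only [mul_apply_eq_comp] at this
    rw [this]
  refine ⟨⟨d, hmem⟩, ?_, hlim⟩
  change ‖d‖ ≤ C
  refine ContinuousLinearMap.opNorm_le_bound _ hC fun ξ => ?_
  have h1 : ‖d ξ‖ * ‖d ξ‖ ≤ C * ‖ξ‖ * ‖d ξ‖ := by
    have h2 := hln ξ (d ξ)
    have h3 := Complex.re_le_norm ⟪d ξ, d ξ⟫_ℂ
    have h4 : (⟪d ξ, d ξ⟫_ℂ).re = ‖d ξ‖ * ‖d ξ‖ := inner_self_eq_norm_mul_norm (𝕜 := ℂ) (d ξ)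
    rw [← hdB] at h2
    linarith
  rcases (norm_nonneg (d ξ)).eq_or_lt with h | h
  · rw [← h]; positivity
  · exact le_of_mul_le_mul_right h1 h

/-- A normal functional is weak-operator continuous on bounded sets. -/
theorem IsNormal.tendsto {M : VonNeumannAlgebra H} {τ : StrongDual ℂ M} (hτ : IsNormal M τ)
    {ι : Type*} {f : Filter ι} {C : ℝ} {c : ι → M} {d : M}
    (hc : ∀ᶠ i in f, ‖c i‖ ≤ C)
    (hd : ∀ ξ η : H, Tendsto (fun i => ⟪ξ, (c i : H →L[ℂ] H) η⟫_ℂ) f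
      (𝓝 ⟪ξ, (d : H →L[ℂ] H) η⟫_ℂ)) (z : M) :
    Tendsto (fun i => τ (c i * z)) f (𝓝 (τ (d * z))) := by
  obtain ⟨ξ, η, hξ, hη, h⟩ := hτ
  have e : ∀ a : M, τ (a * z) =
      ∑' n, ⟪ξ n, (a : H →L[ℂ] H) ((z : H →L[ℂ] H) (η n))⟫_ℂ := fun a => (h (a * z)).tsum_eq.symm
  simp only [e]
  refine tendsto_tsum_of_dominated_convergence
    (bound := fun n => C * ‖z‖ * (‖ξ n‖ ^ 2 + ‖η n‖ ^ 2)) ((hξ.add hη).mul_left _)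
    (fun n => hd _ _) ?_
  filter_upwards [hc] with i hi n
  have hC : 0 ≤ C := (norm_nonneg _).trans hi
  have h1 : ‖(z : H →L[ℂ] H) (η n)‖ ≤ ‖z‖ * ‖η n‖ := ContinuousLinearMap.le_opNorm _ _
  have h2 : ‖(c i : H →L[ℂ] H) ((z : H →L[ℂ] H) (η n))‖ ≤ C * (‖z‖ * ‖η n‖) :=
    (ContinuousLinearMap.le_opNorm _ _).trans (mul_le_mul hi h1 (norm_nonneg _) hC)
  calc _ ≤ ‖ξ n‖ * (C * (‖z‖ * ‖η n‖)) := (norm_inner_le_norm _ _).trans (by gcongr)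
    _ = C * ‖z‖ * (‖ξ n‖ * ‖η n‖) := by ring
    _ ≤ _ := by gcongr; nlinarith [sq_nonneg (‖ξ n‖ - ‖η n‖), sq_nonneg (‖ξ n‖ + ‖η n‖)]

/-- The duality `(L¹)* = M`, isometrically: a functional dominated by `C ‖·‖₁` is `τ(c ·)` for some
`c ∈ M` of operator norm at most `C`. The functionals of this form are a weak-⋆ closed convex set,
and a separating element `z` would violate the domination, as `‖z‖₁ = sup {|τ(c z)| : ‖c‖ ≤ 1}`. -/
theorem exists_toDual_eq {M : VonNeumannAlgebra H} {τ : StrongDual ℂ M} (hτ : IsFaithfulTrace τ)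
    (hn : IsNormal M τ) {φ : StrongDual ℂ M} {C : ℝ} (hC : 0 ≤ C)
    (hφ : ∀ z, ‖φ z‖ ≤ C * ‖toDual τ z‖) : ∃ c : M, ‖c‖ ≤ C ∧ toDual τ c = φ := by
  -- `WeakBilin B` is the dual of `M` with its weak-⋆ topology.
  let B := topDualPairing ℂ M
  let K : Set (WeakBilin B) := {ψ | ∃ c : M, ‖c‖ ≤ C ∧ toDual τ c = ψ}
  have hconv : Convex ℝ K := by
    rintro _ ⟨a, ha, rfl⟩ _ ⟨b, hb, rfl⟩ s t hs ht hst
    refine ⟨(s : ℂ) • a + (t : ℂ) • b, ?_, ?_⟩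
    · refine (norm_add_le _ _).trans ?_
      rw [norm_smul, norm_smul, Complex.norm_of_nonneg hs, Complex.norm_of_nonneg ht]
      nlinarith
    · rw [map_add, map_smul, map_smul]
      rfl
  have hclosed : IsClosed K := by
    rw [isClosed_iff_ultrafilter]
    intro ψ u hu hK
    choose! c hcn hc using fun (χ : WeakBilin B) (h : χ ∈ K) => h
    have hb : ∀ᶠ χ in (u : Filter (WeakBilin B)), ‖c χ‖ ≤ C := by
      filter_upwards [hK] with χ hχ using hcn χ hχ
    obtain ⟨d, hdn, hd⟩ := exists_weak_limit M u hC c hb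
    refine ⟨d, hdn, ?_⟩
    ext z
    refine tendsto_nhds_unique (hn.tendsto hb hd z) ?_
    have h1 : Tendsto (fun χ : WeakBilin B => B χ z) u (𝓝 (B ψ z)) :=
      ((WeakBilin.eval_continuous B z).tendsto ψ).mono_left hu
    refine h1.congr' ?_
    filter_upwards [hK] with χ hχ
    rw [← toDual_apply, hc χ hχ]
    rfl
  by_contra hcon
  have hφK : (φ : WeakBilin B) ∉ K := fun ⟨c, h1, h2⟩ => hcon ⟨c, h1, h2⟩
  have : ContinuousSMul ℝ (WeakBilin B) := IsScalarTower.continuousSMul ℂ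
  obtain ⟨f, s, hs, hsφ⟩ := RCLike.geometric_hahn_banach_closed_point (𝕜 := ℂ) hconv hclosed hφK
  obtain ⟨z, rfl⟩ := LinearMap.dualEmbedding_surjective B f
  have hs' : ∀ c : M, ‖c‖ ≤ C → (τ (c * z)).re < s := fun c hc => hs _ ⟨c, hc, rfl⟩
  have hsφ' : s < (φ z).re := hsφ
  have hs0 : 0 < s := by simpa using hs' 0 (by simpa using hC)
  -- Test against `c = C • e • v / ‖v‖`, with the phase `e` making `τ(z v)` a nonnegative number.
  have h1 : C * ‖toDual τ z‖ ≤ s := by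
    rcases hC.eq_or_lt with rfl | hC
    · simpa using hs0.le
    rw [← le_div_iff₀' hC]
    refine ContinuousLinearMap.opNorm_le_bound _ (by positivity) fun v => ?_
    rcases eq_or_ne v 0 with rfl | hv
    · simp
    have hv' : 0 < ‖v‖ := norm_pos_iff.2 hv
    obtain ⟨e, he, hez⟩ := Complex.exists_norm_eq_mul_self (τ (z * v))
    have h2 := hs' (((C / ‖v‖ : ℝ) : ℂ) • e • v) (by
      rw [norm_smul, norm_smul, he, Complex.norm_of_nonneg (by positivity)]
      field_simp; rfl)
    rw [smul_mul_assoc, smul_mul_assoc, map_smul, map_smul, hτ.tracial, smul_eq_mul, smul_eq_mul,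
      ← hez, ← Complex.ofReal_mul, Complex.ofReal_re] at h2
    rw [toDual_apply]
    rw [div_mul_eq_mul_div, le_div_iff₀ hC]
    rw [div_mul_eq_mul_div, div_lt_iff₀ hv'] at h2
    linarith
  have := (Complex.re_le_norm (φ z)).trans (hφ z)
  linarith

end WeakLimit

/-! ### Analytic families and interpolation of trilinear forms -/

section Family

variable {A : Type*} [CStarAlgebra A]

/-- The `1`-norm is an ideal norm: `‖a b c‖₁ ≤ ‖a‖ ‖b‖₁ ‖c‖`. -/
theorem norm_toDual_mul_mul_le (τ : StrongDual ℂ A) (hτ : ∀ x y, τ (x * y) = τ (y * x))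
    (a b c : A) : ‖toDual τ (a * b * c)‖ ≤ ‖a‖ * ‖toDual τ b‖ * ‖c‖ := by
  refine ContinuousLinearMap.opNorm_le_bound _ (by positivity) fun v => ?_
  have : toDual τ (a * b * c) v = toDual τ b (c * v * a) := by
    rw [toDual_apply, toDual_apply, mul_assoc, mul_assoc, hτ]
    simp only [mul_assoc]
  rw [this]
  calc _ ≤ ‖toDual τ b‖ * ‖c * v * a‖ := ContinuousLinearMap.le_opNorm _ _
    _ ≤ ‖toDual τ b‖ * (‖c‖ * ‖v‖ * ‖a‖) := by
      gcongr
      exact (norm_mul_le _ _).trans (by gcongr; exact norm_mul_le _ _)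
    _ = _ := by ring

/-- The zero algebra, where `‖1‖ = 0`, is not excluded. -/
theorem norm_one_le_one : ‖(1 : A)‖ ≤ 1 := by
  have h : ‖(1 : A)‖ * ‖(1 : A)‖ = ‖(1 : A)‖ := by
    rw [← CStarRing.norm_star_mul_self]
    simp
  nlinarith [norm_nonneg (1 : A)]

theorem norm_exp_im_smul_le {a : A} (ha : IsSelfAdjoint a) (t : ℝ) :
    ‖NormedSpace.exp (((t : ℂ) * Complex.I) • a)‖ ≤ 1 := by
  have hta : IsSelfAdjoint ((t : ℂ) • a) := by
    rw [Complex.coe_smul]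
    exact (IsSelfAdjoint.all t).smul ha
  have h := (selfAdjoint.expUnitary ⟨(t : ℂ) • a, hta⟩).2
  rw [selfAdjoint.expUnitary_coe, smul_smul, mul_comm] at h
  have h1 := Unitary.star_mul_self_of_mem h
  have h2 := CStarRing.norm_star_mul_self (x := NormedSpace.exp (((t : ℂ) * Complex.I) • a))
  rw [h1] at h2
  nlinarith [norm_one_le_one (A := A)]

/-- Splits `exp(s a)` into its modulus and, for `a` self-adjoint, a unitary. -/
theorem exp_smul_eq (a : A) (s : ℂ) : NormedSpace.exp (s • a) =
    NormedSpace.exp ((s.re : ℂ) • a) * NormedSpace.exp (((s.im : ℂ) * Complex.I) • a) := by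
  let _ : NormedAlgebra ℚ A := .restrictScalars ℚ ℂ A
  rw [← NormedSpace.exp_add_of_commute (((Commute.refl a).smul_left _).smul_right _), ← add_smul,
    Complex.re_add_im]

theorem exp_real_smul {a : A} (ha : IsSelfAdjoint a) (θ : ℝ) :
    NormedSpace.exp ((θ : ℂ) • a) = cfc (fun t : ℝ => Real.exp (θ * t)) a := by
  rw [Complex.coe_smul, ← CFC.real_exp_eq_normedSpace_exp ((IsSelfAdjoint.all θ).smul ha)]
  exact (cfc_comp_smul θ Real.exp a (by fun_prop) ha).symm

theorem norm_toDual_exp {τ : StrongDual ℂ A} (hτ : IsFaithfulTrace τ) {a : A}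
    (ha : IsSelfAdjoint a) :
    ‖toDual τ (NormedSpace.exp a)‖ = (τ (NormedSpace.exp a)).re := by
  have h : ‖toDual τ (NormedSpace.exp a)‖ = ‖toL1 τ (NormedSpace.exp a)‖ := rfl
  rw [h, norm_toL1 hτ, pNorm, if_neg (by simp)]
  simp only [ENNReal.toReal_one, div_one, Real.rpow_one]
  rw [absPow, ← CFC.real_exp_eq_normedSpace_exp ha,
    (IsSelfAdjoint.cfc (f := Real.exp) (a := a)).star_eq, ← cfc_mul _ _ a,
    ← cfc_comp' (fun t : ℝ => t ^ ((1 : ℝ) / 2)) (fun t => Real.exp t * Real.exp t) a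
      ((Real.continuous_rpow_const (by norm_num)).continuousOn)]
  congr 2
  refine cfc_congr fun t _ => ?_
  simp only [← Real.sqrt_eq_rpow]
  exact Real.sqrt_mul_self (Real.exp_pos t).le

/-- An entire family of elements, bounded on the strip `0 ≤ re s ≤ 1`, contractive in the operator
norm on the line `re s = 0` and in the `1`-norm on the line `re s = 1`. Its value at `θ ∈ [0, 1]`
plays the role of an element of the unit ball of `L^{1/θ}`. -/
structure IsAnalyticFamily (τ : StrongDual ℂ A) (X : ℂ → A) : Prop where
  differentiable : Differentiable ℂ X
  bounded : ∃ C : ℝ, ∀ s : ℂ, s.re ∈ Set.Icc (0 : ℝ) 1 → ‖X s‖ ≤ C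
  norm_le_one : ∀ s : ℂ, s.re = 0 → ‖X s‖ ≤ 1
  norm_toDual_le_one : ∀ s : ℂ, s.re = 1 → ‖toDual τ (X s)‖ ≤ 1

theorem isAnalyticFamily_mul_exp_mul {τ : StrongDual ℂ A} (hτ : IsFaithfulTrace τ) {a v w : A}
    (ha : IsSelfAdjoint a) (ha1 : (τ (NormedSpace.exp a)).re ≤ 1) (hv : ‖v‖ ≤ 1) (hw : ‖w‖ ≤ 1) :
    IsAnalyticFamily τ fun s => v * NormedSpace.exp (s • a) * w := by
  have hd : Differentiable ℂ fun s : ℂ => NormedSpace.exp (s • a) :=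
    fun s => (hasDerivAt_exp_smul_const a s).differentiableAt
  have hle : ∀ (s : ℂ) (C : ℝ), ‖NormedSpace.exp ((s.re : ℂ) • a)‖ ≤ C →
      ‖v * NormedSpace.exp (s • a) * w‖ ≤ C := fun s C hC => by
    have hC0 : 0 ≤ C := (norm_nonneg _).trans hC
    have h1 : ‖NormedSpace.exp (s • a)‖ ≤ C * 1 := by
      rw [exp_smul_eq]
      exact (norm_mul_le _ _).trans (mul_le_mul hC (norm_exp_im_smul_le ha _) (norm_nonneg _)
        ((norm_nonneg _).trans hC))
    calc _ ≤ ‖v‖ * ‖NormedSpace.exp (s • a)‖ * ‖w‖ :=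
          (norm_mul_le _ _).trans (by gcongr; exact norm_mul_le _ _)
      _ ≤ 1 * (C * 1) * 1 := by gcongr
      _ = C := by ring
  refine ⟨(hd.const_mul v).mul_const w, ?_, ?_, ?_⟩
  · obtain ⟨C, hC⟩ := (isCompact_Icc (a := (0 : ℝ)) (b := 1)).exists_bound_of_continuousOn
      (f := fun t : ℝ => NormedSpace.exp ((t : ℂ) • a))
      (hd.continuous.comp Complex.continuous_ofReal).continuousOn
    exact ⟨C, fun s hs => hle s C (hC _ hs)⟩
  · intro s hs
    refine hle s 1 ?_
    rw [hs]
    simpa using norm_one_le_one (A := A)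
  · intro s hs
    rw [exp_smul_eq, hs, ← mul_assoc, mul_assoc _ _ w]
    refine (norm_toDual_mul_mul_le τ hτ.tracial _ _ _).trans ?_
    rw [Complex.ofReal_one, one_smul, norm_toDual_exp hτ ha]
    have h1 : ‖NormedSpace.exp (((s.im : ℂ) * Complex.I) • a) * w‖ ≤ 1 * 1 :=
      (norm_mul_le _ _).trans
        (mul_le_mul (norm_exp_im_smul_le ha _) hw (norm_nonneg _) zero_le_one)
    calc _ ≤ ‖v‖ * 1 * (1 * 1) := by gcongr
      _ ≤ 1 := by simpa using hv

/-- Hadamard's three lines theorem with the same bound on both lines. -/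
theorem norm_le_of_strip {f : ℂ → ℂ} {k C : ℝ} (hk : 0 < k) (hd : Differentiable ℂ f)
    (hC : ∀ z : ℂ, z.re ∈ Set.Icc (0 : ℝ) 1 → ‖f z‖ ≤ C)
    (h0 : ∀ z : ℂ, z.re = 0 → ‖f z‖ ≤ k) (h1 : ∀ z : ℂ, z.re = 1 → ‖f z‖ ≤ k)
    (z : ℂ) (hz : z.re ∈ Set.Icc (0 : ℝ) 1) : ‖f z‖ ≤ k := by
  have h := Complex.HadamardThreeLines.norm_le_interp_of_mem_verticalClosedStrip' (f := f)
    (a := k) (b := k) zero_lt_one hz hd.diffContOnCl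
    ⟨C, by rintro _ ⟨s, hs, rfl⟩; exact hC s hs⟩ h0 h1
  rwa [← Real.rpow_add hk, sub_add_cancel, Real.rpow_one] at h

set_option maxSynthPendingDepth 3 in
/-- Riesz–Thorin interpolation in the triangle of exponents `(α, β, γ) = (1/p, 1/q, 1/r')` with
vertices `(1, 1, 0)`, `(1, 0, 1)`, `(0, 1, 1)`. The three lines theorem is used twice: along the edge
joining the first two vertices, with arbitrary imaginary parts, and then along the segment from the
third vertex, through the given point, to that edge. -/
theorem norm_trilinear_le {τ : StrongDual ℂ A} {k : ℝ} (hk : 0 < k)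
    (T : A →L[ℂ] A →L[ℂ] A →L[ℂ] ℂ)
    (hxy : ∀ x y z, ‖T x y z‖ ≤ k * ‖toDual τ x‖ * ‖toDual τ y‖ * ‖z‖)
    (hxz : ∀ x y z, ‖T x y z‖ ≤ k * ‖toDual τ x‖ * ‖y‖ * ‖toDual τ z‖)
    (hyz : ∀ x y z, ‖T x y z‖ ≤ k * ‖x‖ * ‖toDual τ y‖ * ‖toDual τ z‖)
    {X Y Z : ℂ → A} (hX : IsAnalyticFamily τ X) (hY : IsAnalyticFamily τ Y)
    (hZ : IsAnalyticFamily τ Z) {α β γ : ℝ} (hα0 : 0 ≤ α) (hα : α ≤ 1) (hβ : β ≤ 1) (hγ : γ ≤ 1)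
    (hsum : α + β + γ = 2) : ‖T (X α) (Y β) (Z γ)‖ ≤ k := by
  obtain ⟨CX, hCX⟩ := hX.bounded
  obtain ⟨CY, hCY⟩ := hY.bounded
  obtain ⟨CZ, hCZ⟩ := hZ.bounded
  have hprod : ∀ a b c : ℝ, 0 ≤ a → 0 ≤ b → 0 ≤ c → a ≤ 1 → b ≤ 1 → c ≤ 1 →
      k * a * b * c ≤ k := fun a b c ha hb hc ha1 hb1 hc1 => by
    calc k * a * b * c ≤ k * 1 * 1 * 1 := by gcongr
      _ = k := by ring
  have hbdd : ∀ s t u : ℂ, s.re ∈ Set.Icc (0 : ℝ) 1 → t.re ∈ Set.Icc (0 : ℝ) 1 →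
      u.re ∈ Set.Icc (0 : ℝ) 1 → ‖T (X s) (Y t) (Z u)‖ ≤ ‖T‖ * CX * CY * CZ :=
      fun s t u hs ht hu => by
    have hX0 := (norm_nonneg _).trans (hCX s hs)
    have hY0 := (norm_nonneg _).trans (hCY t ht)
    calc _ ≤ ‖T (X s) (Y t)‖ * ‖Z u‖ := ContinuousLinearMap.le_opNorm _ _
      _ ≤ ‖T‖ * ‖X s‖ * ‖Y t‖ * ‖Z u‖ := by
        gcongr
        exact ContinuousLinearMap.le_opNorm₂ _ _ _
      _ ≤ _ := by
        gcongr
        exacts [hCX s hs, hCY t ht, hCZ u hu]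
  have hdiff : ∀ f g h : ℂ → ℂ, Differentiable ℂ f → Differentiable ℂ g → Differentiable ℂ h →
      Differentiable ℂ fun s => T (X (f s)) (Y (g s)) (Z (h s)) := fun f g h hf hg hh =>
    ((T.differentiable.comp (hX.differentiable.comp hf)).clm_apply
      (hY.differentiable.comp hg)).clm_apply (hZ.differentiable.comp hh)
  have edge : ∀ s t u : ℂ, s.re = 1 → t.re ∈ Set.Icc (0 : ℝ) 1 → t.re + u.re = 1 →
      ‖T (X s) (Y t) (Z u)‖ ≤ k := by
    intro s t u hs ht htu
    have h := norm_le_of_strip (k := k) (C := ‖T‖ * CX * CY * CZ)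
      (f := fun z => T (X s) (Y (z + t.im * Complex.I)) (Z (1 - z + u.im * Complex.I)))
      hk (hdiff (fun _ => s) _ _ (by fun_prop) (by fun_prop) (by fun_prop))
      (fun z hz => hbdd _ _ _ (by simp [hs]) (by simpa using hz)
        (by simp at hz ⊢; constructor <;> linarith))
      (fun z hz => (hxz _ _ _).trans (hprod _ _ _ (norm_nonneg _) (norm_nonneg _) (norm_nonneg _)
        (hX.norm_toDual_le_one _ hs) (hY.norm_le_one _ (by simp [hz]))
        (hZ.norm_toDual_le_one _ (by simp [hz]))))
      (fun z hz => (hxy _ _ _).trans (hprod _ _ _ (norm_nonneg _) (norm_nonneg _) (norm_nonneg _)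
        (hX.norm_toDual_le_one _ hs) (hY.norm_toDual_le_one _ (by simp [hz]))
        (hZ.norm_le_one _ (by simp [hz]))))
      (t.re : ℂ) (by simpa using ht)
    have e1 : (t.re : ℂ) + t.im * Complex.I = t := Complex.re_add_im t
    have e2 : 1 - (t.re : ℂ) + u.im * Complex.I = u := by
      apply Complex.ext
      · simp; linarith
      · simp
    simpa only [e1, e2] using h
  have vert : ∀ s t u : ℂ, s.re = 0 → t.re = 1 → u.re = 1 → ‖T (X s) (Y t) (Z u)‖ ≤ k :=
    fun s t u hs ht hu => (hyz _ _ _).trans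
      (hprod _ _ _ (norm_nonneg _) (norm_nonneg _) (norm_nonneg _) (hX.norm_le_one _ hs)
        (hY.norm_toDual_le_one _ ht) (hZ.norm_toDual_le_one _ hu))
  rcases hα0.eq_or_lt with rfl | hα0
  · exact vert _ _ _ (by simp) (by simp; linarith) (by simp; linarith)
  -- `(1, e, 1 - e)` is where the line from `(0, 1, 1)` through `(α, β, γ)` meets the opposite edge.
  set e : ℝ := (1 - γ) / α with he
  have he0 : 0 ≤ e := div_nonneg (by linarith) hα0.le
  have he1 : e ≤ 1 := (div_le_one hα0).2 (by linarith)
  have heα : e * α = 1 - γ := div_mul_cancel₀ _ hα0.ne'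
  have h := norm_le_of_strip (k := k) (C := ‖T‖ * CX * CY * CZ)
    (f := fun z => T (X z) (Y (1 - z + z * e)) (Z (1 - z * e)))
    hk (hdiff _ _ _ (by fun_prop) (by fun_prop) (by fun_prop))
    (fun z hz => hbdd _ _ _ hz
      (by simp at hz ⊢; constructor <;> nlinarith)
      (by simp at hz ⊢; constructor <;> nlinarith))
    (fun z hz => vert _ _ _ hz (by simp [hz]) (by simp [hz]))
    (fun z hz => edge _ _ _ hz (by simp [hz, he0, he1]) (by simp [hz]))
    (α : ℂ) (by simpa using ⟨hα0.le, hα⟩)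
  have e1 : 1 - (α : ℂ) + α * e = β := by
    rw [← Complex.ofReal_mul, mul_comm α e, heα, show β = 2 - α - γ by linarith]
    push_cast; ring
  have e2 : 1 - (α : ℂ) * e = γ := by
    rw [← Complex.ofReal_mul, mul_comm α e, heα]
    push_cast; ring
  simpa only [e1, e2] using h

end Family

/-! ### Regularized polar decomposition and the `p`-norms -/

section Polar

variable {A : Type*} [CStarAlgebra A]

theorem spectrum_star_mul_self_nonneg (x : A) : ∀ t ∈ spectrum ℝ (star x * x), 0 ≤ t := by
  let _ := CStarAlgebra.spectralOrder A
  have _ := CStarAlgebra.spectralOrderedRing A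
  exact fun t ht => spectrum_nonneg_of_nonneg (star_mul_self_nonneg x) ht

theorem re_cfc_add_const (τ : StrongDual ℂ A) {b : A} (hb : IsSelfAdjoint b) {f : ℝ → ℝ}
    (hf : ContinuousOn f (spectrum ℝ b)) (c : ℝ) :
    (τ (cfc (fun t => f t + c) b)).re = (τ (cfc f b)).re + c * (τ 1).re := by
  rw [cfc_add b f (fun _ => c) hf (by fun_prop), cfc_const c b, Algebra.algebraMap_eq_smul_one,
    ← Complex.coe_smul, map_add, map_smul]
  simp

theorem IsFaithfulTrace.re_absPow_nonneg {τ : StrongDual ℂ A} (hτ : IsFaithfulTrace τ) (x : A)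
    {p : ℝ} (hp : 0 ≤ p) : 0 ≤ (τ (absPow x p)).re :=
  hτ.re_nonneg (b := star x * x) (Real.continuous_rpow_const (by positivity)).continuousOn
    fun t ht => Real.rpow_nonneg (spectrum_star_mul_self_nonneg x t ht) _

theorem IsFaithfulTrace.re_one_nonneg {τ : StrongDual ℂ A} (hτ : IsFaithfulTrace τ) :
    0 ≤ (τ 1).re := by
  simpa using (Complex.nonneg_iff.1 (hτ.nonneg 1)).1

/-- A polar decomposition with regularized modulus `m = (|x|^p + ε)^{1/p}`: `w = x m⁻¹` is a
contraction and `exp a` is the normalization `m^p / (τ(|x|^p) + ε (τ(1) + 1))`. Adding `ε` to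
`|x|^p` rather than to `|x|` makes `τ(m^p)` affine in `ε`; the summand `1` in `τ(1) + 1` keeps the
normalizing constant positive in the zero algebra. -/
theorem exists_regularized_polar {τ : StrongDual ℂ A} (hτ : IsFaithfulTrace τ) (x : A) {p ε : ℝ}
    (hp : 1 ≤ p) (hε : 0 < ε) :
    ∃ a w : A, IsSelfAdjoint a ∧ (τ (NormedSpace.exp a)).re ≤ 1 ∧ ‖w‖ ≤ 1 ∧
      w = x * cfc (fun t : ℝ => (t ^ (p / 2) + ε) ^ (-(1 / p))) (star x * x) ∧
      ∀ θ : ℝ, NormedSpace.exp ((θ : ℂ) • a) =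
        (((τ (absPow x p)).re + ε * ((τ 1).re + 1)) ^ (-θ)) •
          cfc (fun t : ℝ => (t ^ (p / 2) + ε) ^ θ) (star x * x) := by
  set b := star x * x with hb
  have hsa : IsSelfAdjoint b := IsSelfAdjoint.star_mul_self x
  have hpos : ∀ t ∈ spectrum ℝ b, 0 ≤ t := spectrum_star_mul_self_nonneg x
  have hp0 : 0 < p := by linarith
  have hu : Continuous fun t : ℝ => t ^ (p / 2) := Real.continuous_rpow_const (by positivity)
  have hT : 0 ≤ (τ (1 : A)).re := hτ.re_one_nonneg
  have hN : 0 ≤ (τ (absPow x p)).re :=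
    hτ.re_absPow_nonneg x hp0.le
  set N := (τ (absPow x p)).re + ε * ((τ 1).re + 1) with hNdef
  have hN0 : 0 < N := by positivity
  have hue : ∀ t ∈ spectrum ℝ b, 0 < t ^ (p / 2) + ε := fun t ht => by
    have := Real.rpow_nonneg (hpos t ht) (p / 2)
    linarith
  have hcpow : ∀ θ : ℝ, ContinuousOn (fun t : ℝ => (t ^ (p / 2) + ε) ^ θ) (spectrum ℝ b) :=
    fun θ => (hu.add continuous_const).continuousOn.rpow_const fun t ht => Or.inl (hue t ht).ne'
  have hclog : ContinuousOn (fun t : ℝ => Real.log ((t ^ (p / 2) + ε) / N)) (spectrum ℝ b) :=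
    ((hu.add continuous_const).div_const N).continuousOn.log
      fun t ht => (div_pos (hue t ht) hN0).ne'
  set a := cfc (fun t : ℝ => Real.log ((t ^ (p / 2) + ε) / N)) b with ha
  have hasa : IsSelfAdjoint a := IsSelfAdjoint.cfc
  have hexp : ∀ θ : ℝ, NormedSpace.exp ((θ : ℂ) • a) =
      (N ^ (-θ)) • cfc (fun t : ℝ => (t ^ (p / 2) + ε) ^ θ) b := by
    intro θ
    rw [exp_real_smul hasa, ha, ← cfc_comp' (fun t : ℝ => Real.exp (θ * t)) _ b (by fun_prop) hclog,
      ← cfc_const_mul _ _ b (hcpow θ)]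
    refine cfc_congr fun t ht => ?_
    rw [mul_comm, ← Real.rpow_def_of_pos (div_pos (hue t ht) hN0),
      Real.div_rpow (hue t ht).le hN0.le, Real.rpow_neg hN0.le, div_eq_inv_mul]
  refine ⟨a, x * cfc (fun t : ℝ => (t ^ (p / 2) + ε) ^ (-(1 / p))) b, hasa, ?_, ?_, rfl, hexp⟩
  · have h1 := hexp 1
    simp only [Complex.ofReal_one, one_smul, Real.rpow_one] at h1
    rw [h1, ← Complex.coe_smul, map_smul, smul_eq_mul, Complex.re_ofReal_mul,
      re_cfc_add_const τ hsa hu.continuousOn, Real.rpow_neg_one, inv_mul_le_iff₀ hN0, mul_one,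
      hNdef]
    have : (τ (cfc (fun t : ℝ => t ^ (p / 2)) b)).re = (τ (absPow x p)).re := rfl
    rw [this]
    linarith
  · set g := fun t : ℝ => (t ^ (p / 2) + ε) ^ (-(1 / p)) with hg
    have cg : ContinuousOn g (spectrum ℝ b) := hcpow _
    have e : star (x * cfc g b) * (x * cfc g b) = cfc (fun t : ℝ => g t * t * g t) b := by
      rw [cfc_mul (fun t : ℝ => g t * t) _ b (cg.mul continuousOn_id) cg,
        cfc_mul g (fun t => t) b cg continuousOn_id, cfc_id' ℝ b, star_mul,
        (IsSelfAdjoint.cfc (f := g) (a := b)).star_eq, hb]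
      simp only [mul_assoc]
    have h1 : ‖x * cfc g b‖ * ‖x * cfc g b‖ ≤ 1 := by
      rw [← CStarRing.norm_star_mul_self, e]
      refine norm_cfc_le zero_le_one fun t ht => ?_
      have h0 := hpos t ht
      have hg0 : 0 ≤ g t := Real.rpow_nonneg (hue t ht).le _
      rw [Real.norm_of_nonneg (by positivity)]
      have h2 : √t ≤ (t ^ (p / 2) + ε) ^ (1 / p) := by
        have h2 : √t = (t ^ (p / 2)) ^ (1 / p) := by
          rw [← Real.rpow_mul h0, Real.sqrt_eq_rpow]
          congr 1
          field_simp
        rw [h2]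
        exact Real.rpow_le_rpow (Real.rpow_nonneg h0 _) (by linarith) (by positivity)
      have h3 : √t * g t ≤ 1 := by
        rw [hg]
        simp only
        rw [Real.rpow_neg (hue t ht).le, ← div_eq_mul_inv,
          div_le_one (Real.rpow_pos_of_pos (hue t ht) _)]
        exact h2
      have h4 : g t * t * g t = (√t * g t) * (√t * g t) := by
        nth_rewrite 2 [← Real.mul_self_sqrt h0]
        ring
      rw [h4]
      exact mul_le_one₀ h3 (by positivity) h3
    nlinarith [norm_nonneg (x * cfc g b)]

theorem pNorm_nonneg {τ : StrongDual ℂ A} (hτ : IsFaithfulTrace τ) (p : ℝ≥0∞) (x : A) :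
    0 ≤ pNorm τ p x := by
  rw [pNorm]
  split_ifs with h
  · exact norm_nonneg x
  · exact Real.rpow_nonneg (hτ.re_absPow_nonneg x ENNReal.toReal_nonneg) _

/-- Up to `δ`, an element is `‖x‖_p` times the value at `1/p` of an analytic family. -/
theorem exists_analyticFamily {τ : StrongDual ℂ A} (hτ : IsFaithfulTrace τ) (x : A) {p : ℝ≥0∞}
    (hp : 1 ≤ p) {δ : ℝ} (hδ : 0 < δ) :
    ∃ (X : ℂ → A) (c : ℝ), IsAnalyticFamily τ X ∧ 0 ≤ c ∧ c ≤ pNorm τ p x + δ ∧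
      x = (c : ℂ) • X ((p⁻¹).toReal : ℂ) := by
  have hT : 0 ≤ (τ (1 : A)).re := hτ.re_one_nonneg
  by_cases hpt : p = ∞
  · subst hpt
    -- At `p = ∞` the value at `0` is needed: `s ↦ (τ(1) + 1)^{-s} x / (‖x‖ + δ)` has `τ(exp a) ≤ 1`.
    have hc : 0 < ‖x‖ + δ := by positivity
    have hexp : NormedSpace.exp (((-Real.log ((τ (1 : A)).re + 1) : ℝ) : ℂ) • (1 : A))
        = (((τ (1 : A)).re + 1)⁻¹ : ℝ) • (1 : A) := by
      rw [exp_real_smul (IsSelfAdjoint.one A)]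
      have h1 : cfc (fun t : ℝ => Real.exp (-Real.log ((τ (1 : A)).re + 1) * t)) (1 : A) =
          cfc (fun _ : ℝ => ((τ (1 : A)).re + 1)⁻¹) (1 : A) := by
        refine cfc_congr fun t ht => ?_
        have h2 : t = 1 := by
          by_cases hA : Nontrivial A
          · rw [spectrum.one_eq] at ht; exact ht
          · have := not_nontrivial_iff_subsingleton.1 hA
            simp [spectrum.of_subsingleton] at ht
        rw [h2]
        simp only [mul_one]
        rw [Real.exp_neg, Real.exp_log (by positivity)]
      rw [h1, cfc_const _ _ (IsSelfAdjoint.one A), Algebra.algebraMap_eq_smul_one]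
    refine ⟨_, ‖x‖ + δ, isAnalyticFamily_mul_exp_mul hτ
      (a := ((-Real.log ((τ (1 : A)).re + 1) : ℝ) : ℂ) • (1 : A))
      (v := (((‖x‖ + δ)⁻¹ : ℝ) : ℂ) • x) (w := 1) ?_ ?_ ?_ norm_one_le_one, hc.le, ?_, ?_⟩
    · rw [Complex.coe_smul]
      exact (IsSelfAdjoint.all _).smul (IsSelfAdjoint.one A)
    · rw [hexp, ← Complex.coe_smul, map_smul, smul_eq_mul, Complex.re_ofReal_mul,
        inv_mul_le_iff₀ (by positivity)]
      linarith
    · rw [norm_smul, Complex.norm_of_nonneg (by positivity), inv_mul_le_iff₀ hc]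
      linarith
    · simp [pNorm]
    · have : (((‖x‖ + δ : ℝ)) : ℂ) ≠ 0 := by exact_mod_cast hc.ne'
      simp only [ENNReal.inv_top, ENNReal.toReal_zero, Complex.ofReal_zero, zero_smul,
        NormedSpace.exp_zero, mul_one]
      rw [smul_smul, ← Complex.ofReal_mul, mul_inv_cancel₀ hc.ne', Complex.ofReal_one, one_smul]
  · set P := p.toReal with hP
    have hP1 : 1 ≤ P := by
      rw [hP, ← ENNReal.toReal_one]
      exact ENNReal.toReal_mono hpt hp
    have hP0 : 0 < P := by linarith
    set N := (τ (absPow x P)).re with hN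
    have hN0 : 0 ≤ N := hτ.re_absPow_nonneg x hP0.le
    have hcont : Continuous fun ε : ℝ => (N + ε * ((τ (1 : A)).re + 1)) ^ (1 / P) :=
      (by fun_prop : Continuous fun ε : ℝ => N + ε * ((τ (1 : A)).re + 1)).rpow_const
        fun _ => Or.inr (by positivity)
    have hlim : ∀ᶠ ε in 𝓝[>] (0 : ℝ),
        (N + ε * ((τ (1 : A)).re + 1)) ^ (1 / P) < N ^ (1 / P) + δ :=
      ((hcont.tendsto' 0 (N ^ (1 / P)) (by simp)).mono_left nhdsWithin_le_nhds).eventually_lt_const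
        (by linarith)
    obtain ⟨ε, hεδ, hε⟩ := (hlim.and self_mem_nhdsWithin).exists
    have hε0 : 0 < ε := hε
    obtain ⟨a, w, hasa, ha1, hw1, hw, hexp⟩ := exists_regularized_polar hτ x hP1 hε0
    have hN' : 0 < N + ε * ((τ (1 : A)).re + 1) := by positivity
    have hue : ∀ t ∈ spectrum ℝ (star x * x), 0 < t ^ (P / 2) + ε := fun t ht => by
      have := Real.rpow_nonneg (spectrum_star_mul_self_nonneg x t ht) (P / 2)
      linarith
    have hcpow : ∀ θ : ℝ,
        ContinuousOn (fun t : ℝ => (t ^ (P / 2) + ε) ^ θ) (spectrum ℝ (star x * x)) := fun θ =>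
      ((Real.continuous_rpow_const (by positivity)).add continuous_const).continuousOn.rpow_const
        fun t ht => Or.inl (hue t ht).ne'
    refine ⟨_, (N + ε * ((τ (1 : A)).re + 1)) ^ (1 / P),
      isAnalyticFamily_mul_exp_mul hτ hasa ha1 hw1 norm_one_le_one, by positivity, ?_, ?_⟩
    · rw [pNorm, if_neg hpt]
      exact hεδ.le
    · simp only [mul_one]
      rw [ENNReal.toReal_inv, ← hP, hexp, hw, ← hN, mul_smul_comm, Complex.coe_smul, smul_smul,
        ← Real.rpow_add hN', mul_assoc,
        ← cfc_mul _ _ (star x * x) (hcpow _) (hcpow _), cfc_congr (g := fun _ : ℝ => 1),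
        cfc_const_one ℝ (star x * x)]
      · simp
      · intro t ht
        simp only
        rw [← Real.rpow_add (hue t ht)]
        simp

/-- The `r`-norm by duality, with analytic families at `1 - 1/r` as the unit ball of `L^{r'}`. For
`m = (|c|^r + ε)^{1/r}` and `w = c m⁻¹`, the family through the normalized `m^{r-1} w⋆` pairs with `c`
to at least `τ(|c|^r) - ε τ(1)`, up to the normalization; then `ε → 0`. -/
theorem pNorm_le_of_analyticFamily {τ : StrongDual ℂ A} (hτ : IsFaithfulTrace τ) (c : A) {r : ℝ≥0∞}
    (hr : 1 ≤ r) (hrt : r ≠ ∞) {K : ℝ}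
    (hK : ∀ Z : ℂ → A, IsAnalyticFamily τ Z →
      ‖τ (c * Z ((1 - (r⁻¹).toReal : ℝ) : ℂ))‖ ≤ K) : pNorm τ r c ≤ K := by
  have hT : 0 ≤ (τ (1 : A)).re := hτ.re_one_nonneg
  set P := r.toReal with hP
  have hP1 : 1 ≤ P := by
    rw [hP, ← ENNReal.toReal_one]
    exact ENNReal.toReal_mono hrt hr
  have hP0 : 0 < P := by linarith
  set N := (τ (absPow c P)).re with hN
  set b := star c * c with hb
  have hpos : ∀ t ∈ spectrum ℝ b, 0 ≤ t := spectrum_star_mul_self_nonneg c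
  have hsa : IsSelfAdjoint b := IsSelfAdjoint.star_mul_self c
  have hu : Continuous fun t : ℝ => t ^ (P / 2) := Real.continuous_rpow_const (by positivity)
  have hN0 : 0 ≤ N := hτ.re_absPow_nonneg c hP0.le
  rw [ENNReal.toReal_inv, ← hP] at hK
  have key : ∀ ε : ℝ, 0 < ε → N + (-ε) * (τ (1 : A)).re ≤
      K * (N + ε * ((τ (1 : A)).re + 1)) ^ (1 - P⁻¹) := by
    intro ε hε
    obtain ⟨a, w, hasa, ha1, hw1, hw, hexp⟩ := exists_regularized_polar hτ c hP1 hε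
    have hN' : 0 < N + ε * ((τ (1 : A)).re + 1) := by positivity
    have hue : ∀ t ∈ spectrum ℝ b, 0 < t ^ (P / 2) + ε := fun t ht => by
      have := Real.rpow_nonneg (hpos t ht) (P / 2)
      linarith
    have hcpow : ∀ θ : ℝ, ContinuousOn (fun t : ℝ => (t ^ (P / 2) + ε) ^ θ) (spectrum ℝ b) :=
      fun θ => (hu.add continuous_const).continuousOn.rpow_const fun t ht => Or.inl (hue t ht).ne'
    have h1 := hK _ (isAnalyticFamily_mul_exp_mul hτ hasa ha1 norm_one_le_one
      ((norm_star w).trans_le hw1))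
    simp only [one_mul] at h1
    rw [hexp, ← hN, ← hb] at h1
    set g := fun t : ℝ => (t ^ (P / 2) + ε) ^ (-(1 / P)) with hg
    set h := fun t : ℝ => (t ^ (P / 2) + ε) ^ (1 - P⁻¹) with hh
    have e : τ (c * (((N + ε * ((τ (1 : A)).re + 1)) ^ (-(1 - P⁻¹)) • cfc h b) * star w)) =
        (((N + ε * ((τ (1 : A)).re + 1)) ^ (-(1 - P⁻¹)) : ℝ) : ℂ) *
          τ (cfc (fun t => h t * g t * t) b) := by
      rw [smul_mul_assoc, mul_smul_comm, ← Complex.coe_smul, map_smul, smul_eq_mul, hτ.tracial, hw,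
        star_mul, (IsSelfAdjoint.cfc (f := g) (a := b)).star_eq,
        cfc_mul (fun t => h t * g t) (fun t => t) b ((hcpow _).mul (hcpow _)) continuousOn_id,
        cfc_mul h g b (hcpow _) (hcpow _), cfc_id' ℝ b, hb]
      simp only [mul_assoc]
    rw [e, norm_mul, Complex.norm_of_nonneg (by positivity), Real.rpow_neg hN'.le,
      inv_mul_le_iff₀ (by positivity), mul_comm] at h1
    refine le_trans ?_ h1
    refine le_trans ?_ (Complex.re_le_norm _)
    have h2 := re_cfc_add_const τ hsa hu.continuousOn (-ε)
    have h3 : (τ (cfc (fun t : ℝ => t ^ (P / 2)) b)).re = N := rfl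
    rw [h3] at h2
    rw [← h2]
    refine hτ.re_mono (hu.add continuous_const).continuousOn
      (((hcpow _).mul (hcpow _)).mul continuousOn_id) fun t ht => ?_
    have ht0 := hpos t ht
    have hs0 := hue t ht
    have hu0 : 0 ≤ t ^ (P / 2) := Real.rpow_nonneg ht0 _
    set s := t ^ (P / 2) + ε with hs
    have e1 : h t * g t = s * s ^ (-(2 / P)) := by
      simp only [hh, hg, ← hs]
      nth_rewrite 3 [← Real.rpow_one s]
      rw [← Real.rpow_add hs0, ← Real.rpow_add hs0]
      congr 1
      ring
    have e2 : t = (s - ε) ^ (2 / P) := by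
      rw [hs, add_sub_cancel_right, ← Real.rpow_mul ht0]
      have : P / 2 * (2 / P) = 1 := by field_simp
      rw [this, Real.rpow_one]
    have e3 : h t * g t * t = s * ((s - ε) / s) ^ (2 / P) := by
      rw [e1, Real.div_rpow (by simpa [hs] using hu0) hs0.le, ← e2, Real.rpow_neg hs0.le,
        div_eq_mul_inv]
      ring
    have hv0 : 0 ≤ (s - ε) / s := div_nonneg (by simpa [hs] using hu0) hs0.le
    have hv1 : (s - ε) / s ≤ 1 := (div_le_one hs0).2 (by linarith)
    -- As `2 / r ≤ 2`, the required bound `s - 2 ε` follows from `(1 - ε / s) ^ 2 ≥ 1 - 2 ε / s`.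
    have h4 : ((s - ε) / s) ^ (2 : ℝ) ≤ ((s - ε) / s) ^ (2 / P) :=
      Real.rpow_le_rpow_of_exponent_ge_of_imp hv0 hv1
        ((div_le_iff₀ hP0).2 (by linarith)) (fun _ h => absurd h (by positivity))
    rw [Real.rpow_two] at h4
    have h5 : s * ((s - ε) / s) ^ 2 ≥ s - 2 * ε := by
      rw [div_pow, ge_iff_le, ← mul_div_assoc, le_div_iff₀ (by positivity)]
      nlinarith [mul_pos hs0 (mul_pos hε hε)]
    have h6 := mul_le_mul_of_nonneg_left h4 hs0.le
    rw [e3]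
    linarith
  have hP' : 0 ≤ 1 - P⁻¹ := by
    have := inv_le_one_of_one_le₀ hP1
    linarith
  have hlim : N ≤ K * N ^ (1 - P⁻¹) := by
    have c1 : Continuous fun ε : ℝ => N + (-ε) * (τ (1 : A)).re := by fun_prop
    have c2 : Continuous fun ε : ℝ => K * (N + ε * ((τ (1 : A)).re + 1)) ^ (1 - P⁻¹) :=
      continuous_const.mul ((by fun_prop : Continuous fun ε : ℝ =>
        N + ε * ((τ (1 : A)).re + 1)).rpow_const fun _ => Or.inr hP')
    exact le_of_tendsto_of_tendsto (b := 𝓝[>] (0 : ℝ))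
      ((c1.tendsto' 0 N (by simp)).mono_left nhdsWithin_le_nhds)
      ((c2.tendsto' 0 (K * N ^ (1 - P⁻¹)) (by simp)).mono_left nhdsWithin_le_nhds)
      (by filter_upwards [self_mem_nhdsWithin] with ε hε using key ε hε)
  rw [pNorm, if_neg hrt, ← hP, ← hN]
  rcases hN0.eq_or_lt with h0 | h0
  · rw [← h0, Real.zero_rpow (by positivity)]
    refine (norm_nonneg _).trans (hK (fun s => 0 * NormedSpace.exp (s • (0 : A)) * 0) ?_)
    exact ⟨by simp, ⟨0, by simp⟩, by simp, by simp⟩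
  · have h1 : N ^ (1 / P) * N ^ (1 - P⁻¹) = N := by
      rw [← Real.rpow_add h0]
      simp
    exact le_of_mul_le_mul_right (h1.le.trans hlim) (Real.rpow_pos_of_pos h0 _)

end Polar

/-! ### Young's inequality -/

section Young

variable {A : Type*} [CStarAlgebra A] {τ : StrongDual ℂ A} {k : ℝ}
  {conv : A →ₗ[ℂ] A →ₗ[ℂ] L1 τ} {ρ : A ≃⋆ₐ[ℂ] Aᵐᵒᵖ}

theorem IsGoodConvolution.norm_le (hc : IsGoodConvolution τ k conv) (hτ : IsFaithfulTrace τ)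
    (x y : A) : ‖conv x y‖ ≤ k * ‖toDual τ x‖ * ‖toDual τ y‖ := by
  have h := hc.primary_young x y
  rwa [← norm_toL1 hτ, ← norm_toL1 hτ] at h

theorem IsGoodConvolution.norm_traceMul_le (hc : IsGoodConvolution τ k conv)
    (hτ : IsFaithfulTrace τ) (x y z : A) :
    ‖traceMul τ (conv x y) z‖ ≤ k * ‖toDual τ x‖ * ‖toDual τ y‖ * ‖z‖ :=
  (ContinuousLinearMap.le_opNorm _ _).trans
    (mul_le_mul_of_nonneg_right (hc.norm_le hτ x y) (norm_nonneg z))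

theorem norm_unop_starAlgEquiv (ρ : A ≃⋆ₐ[ℂ] Aᵐᵒᵖ) (x : A) : ‖(ρ x).unop‖ = ‖x‖ :=
  NonUnitalStarAlgHom.norm_map (ρ : A →⋆ₙₐ[ℂ] Aᵐᵒᵖ) ρ.injective x

/-- The antipode preserves the `1`-norm, because it preserves `τ` and the unit ball. -/
theorem IsAntipode.norm_toDual (hρ : IsAntipode τ conv ρ) (hτ : IsFaithfulTrace τ) (x : A) :
    ‖toDual τ (ρ x).unop‖ = ‖toDual τ x‖ := by
  have h : ∀ v, toDual τ (ρ x).unop (ρ v).unop = toDual τ x v := fun v => by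
    rw [toDual_apply, toDual_apply, ← MulOpposite.unop_mul, ← map_mul, hρ.trace_preserving,
      hτ.tracial]
  apply le_antisymm
  · refine ContinuousLinearMap.opNorm_le_bound _ (norm_nonneg _) fun w => ?_
    obtain ⟨v, hv⟩ := ρ.surjective (MulOpposite.op w)
    have hw : w = (ρ v).unop := by
      have hv' : ρ v = MulOpposite.op w := hv
      rw [hv']; rfl
    rw [hw, h, norm_unop_starAlgEquiv]
    exact ContinuousLinearMap.le_opNorm _ _
  · refine ContinuousLinearMap.opNorm_le_bound _ (norm_nonneg _) fun v => ?_
    rw [← h, ← norm_unop_starAlgEquiv ρ v]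
    exact ContinuousLinearMap.le_opNorm _ _

set_option maxSynthPendingDepth 3 in
/-- Young's inequality in trilinear form, with the third argument in the unit ball of `L^{1/γ}`. -/
theorem norm_traceMul_conv_le (hτ : IsFaithfulTrace τ) (hc : IsGoodConvolution τ k conv)
    (hρ : IsAntipode τ conv ρ) {p q : ℝ≥0∞} (hp : 1 ≤ p) (hq : 1 ≤ q) {γ : ℝ} (hγ : γ ≤ 1)
    (hsum : (p⁻¹).toReal + (q⁻¹).toReal + γ = 2) (x y : A) {Z : ℂ → A}
    (hZ : IsAnalyticFamily τ Z) :
    ‖traceMul τ (conv x y) (Z γ)‖ ≤ k * pNorm τ p x * pNorm τ q y := by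
  have hk := hc.pos
  have hτle : ∀ a : A, ‖toDual τ a‖ ≤ ‖toDual τ‖ * ‖a‖ := fun a =>
    ContinuousLinearMap.le_opNorm _ _
  let T : A →L[ℂ] A →L[ℂ] A →L[ℂ] ℂ := LinearMap.mkContinuous₂
    (conv.compr₂ (L1 τ).subtype) (k * ‖toDual τ‖ * ‖toDual τ‖) fun a b => by
      refine (hc.norm_le hτ a b).trans ?_
      calc k * ‖toDual τ a‖ * ‖toDual τ b‖
          ≤ k * (‖toDual τ‖ * ‖a‖) * (‖toDual τ‖ * ‖b‖) := by gcongr <;> exact hτle _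
        _ = _ := by ring
  have hT : ∀ a b c, T a b c = traceMul τ (conv a b) c := fun a b c => rfl
  have hxy : ∀ a b c, ‖T a b c‖ ≤ k * ‖toDual τ a‖ * ‖toDual τ b‖ * ‖c‖ := fun a b c =>
    hc.norm_traceMul_le hτ a b c
  -- Each application of Frobenius reciprocity rotates the argument carrying the operator norm.
  have hxz : ∀ a b c, ‖T a b c‖ ≤ k * ‖toDual τ a‖ * ‖b‖ * ‖toDual τ c‖ := fun a b c => by
    rw [hT, hρ.frobenius]
    refine (hxy _ _ _).trans_eq ?_
    rw [hρ.norm_toDual hτ, norm_unop_starAlgEquiv]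
    ring
  have hyz : ∀ a b c, ‖T a b c‖ ≤ k * ‖a‖ * ‖toDual τ b‖ * ‖toDual τ c‖ := fun a b c => by
    rw [hT, hρ.frobenius]
    refine (hxz _ _ _).trans_eq ?_
    rw [hρ.norm_toDual hτ, hρ.norm_toDual hτ]
    ring
  have hinv : ∀ {s : ℝ≥0∞}, 1 ≤ s → (s⁻¹).toReal ≤ 1 := fun hs => by
    rw [← ENNReal.toReal_one]
    exact ENNReal.toReal_mono ENNReal.one_ne_top (ENNReal.inv_le_one.2 hs)
  have key : ∀ δ : ℝ, 0 < δ →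
      ‖traceMul τ (conv x y) (Z γ)‖ ≤ k * (pNorm τ p x + δ) * (pNorm τ q y + δ) := by
    intro δ hδ
    obtain ⟨X, a, hX, ha0, ha, hxa⟩ := exists_analyticFamily hτ x hp hδ
    obtain ⟨Y, b, hY, hb0, hb, hyb⟩ := exists_analyticFamily hτ y hq hδ
    have h := norm_trilinear_le hk T hxy hxz hyz hX hY hZ ENNReal.toReal_nonneg (hinv hp) (hinv hq)
      hγ hsum
    have e : T x y (Z γ) = (a : ℂ) * ((b : ℂ) * T (X (p⁻¹).toReal) (Y (q⁻¹).toReal) (Z γ)) := by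
      conv_lhs => rw [hxa, hyb]
      simp
    rw [← hT, e, norm_mul, norm_mul, Complex.norm_of_nonneg ha0, Complex.norm_of_nonneg hb0]
    have hx0 := ha0.trans ha
    have hy0 := hb0.trans hb
    calc a * (b * ‖T (X (p⁻¹).toReal) (Y (q⁻¹).toReal) (Z γ)‖)
        ≤ (pNorm τ p x + δ) * ((pNorm τ q y + δ) * k) := by gcongr
      _ = _ := by ring
  have c1 : Continuous fun δ : ℝ => k * (pNorm τ p x + δ) * (pNorm τ q y + δ) := by fun_prop
  exact ge_of_tendsto (x := 𝓝[>] (0 : ℝ))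
    ((c1.tendsto' 0 (k * pNorm τ p x * pNorm τ q y) (by simp)).mono_left nhdsWithin_le_nhds)
    (by filter_upwards [self_mem_nhdsWithin] with δ hδ using key δ hδ)

end Young

section VonNeumann

variable {H : Type*} [NormedAddCommGroup H] [InnerProductSpace ℂ H] [CompleteSpace H]

/-- For conjugate exponents `p`, `q`, the convolution is bounded, with the Young inequality for
`r = ∞`. -/
theorem exists_toL1_eq_conv {M : VonNeumannAlgebra H} {τ : StrongDual ℂ M} {k : ℝ}
    {conv : M →ₗ[ℂ] M →ₗ[ℂ] L1 τ} {ρ : M ≃⋆ₐ[ℂ] (M)ᵐᵒᵖ}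
    (hF : IsFrobeniusVNAlgebra M τ k conv ρ) {p q : ℝ≥0∞} (hp : 1 ≤ p) (hq : 1 ≤ q)
    (hpq : (p⁻¹).toReal + (q⁻¹).toReal = 1) (x y : M) :
    ∃ c : M, toL1 τ c = conv x y ∧ ‖c‖ ≤ k * pNorm τ p x * pNorm τ q y := by
  have hτ := hF.trace
  have hK : 0 ≤ k * pNorm τ p x * pNorm τ q y :=
    mul_nonneg (mul_nonneg hF.convolution.pos.le (pNorm_nonneg hτ p x)) (pNorm_nonneg hτ q y)
  obtain ⟨c, hcn, hc⟩ := exists_toDual_eq hτ hF.normal (φ := (conv x y : StrongDual ℂ M)) hK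
    fun z => by
      have key : ∀ δ : ℝ, 0 < δ → ‖(conv x y : StrongDual ℂ M) z‖ ≤
          (k * pNorm τ p x * pNorm τ q y) * (‖toDual τ z‖ + δ) := by
        intro δ hδ
        obtain ⟨Z, a, hZ, ha0, ha, hza⟩ := exists_analyticFamily hτ z le_rfl hδ
        have h := norm_traceMul_conv_le hτ hF.convolution hF.antipode hp hq (le_refl (1 : ℝ))
          (by rw [hpq]; norm_num) x y hZ
        rw [← norm_toL1 hτ] at ha
        simp only [inv_one, ENNReal.toReal_one] at hza
        have e : (conv x y : StrongDual ℂ M) z = (a : ℂ) * traceMul τ (conv x y) (Z (1 : ℝ)) := by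
          conv_lhs => rw [hza]
          exact map_smul _ _ _
        rw [e, norm_mul, Complex.norm_of_nonneg ha0, mul_comm]
        exact mul_le_mul h ha ha0 hK
      have c1 : Continuous fun δ : ℝ =>
        (k * pNorm τ p x * pNorm τ q y) * (‖toDual τ z‖ + δ) := by fun_prop
      exact ge_of_tendsto (x := 𝓝[>] (0 : ℝ)) ((c1.tendsto' 0
        ((k * pNorm τ p x * pNorm τ q y) * ‖toDual τ z‖) (by simp)).mono_left nhdsWithin_le_nhds)
        (by filter_upwards [self_mem_nhdsWithin] with δ hδ using key δ hδ)
  exact ⟨c, Subtype.ext hc, hcn⟩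

end VonNeumann

end FrobeniusVN

theorem theorem3p11 {H : Type*} [NormedAddCommGroup H] [InnerProductSpace ℂ H] [CompleteSpace H]
    (M : VonNeumannAlgebra H) (τ : StrongDual ℂ M) (k : ℝ)
    (conv : M →ₗ[ℂ] M →ₗ[ℂ] FrobeniusVN.L1 τ) (ρ : M ≃⋆ₐ[ℂ] (M)ᵐᵒᵖ)
    (hF : FrobeniusVN.IsFrobeniusVNAlgebra M τ k conv ρ)
    (p q r : ℝ≥0∞) (hp : 1 ≤ p) (hq : 1 ≤ q) (hr : 1 ≤ r) (hpqr : 1 + r⁻¹ = p⁻¹ + q⁻¹)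
    (x y : M) :
    -- the element `x ∗ y` of `L¹(M)` belongs to `M`, and Young's inequality holds for it
    ∃ c : M, FrobeniusVN.toL1 τ c = conv x y ∧
      FrobeniusVN.pNorm τ r c ≤ k * FrobeniusVN.pNorm τ p x * FrobeniusVN.pNorm τ q y := by
  have hfin : ∀ {s : ℝ≥0∞}, 1 ≤ s → s⁻¹ ≠ ∞ := fun hs =>
    ((ENNReal.inv_le_one.2 hs).trans_lt ENNReal.one_lt_top).ne
  have hsum : 1 + (r⁻¹).toReal = (p⁻¹).toReal + (q⁻¹).toReal := by
    have h := congrArg ENNReal.toReal hpqr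
    rwa [ENNReal.toReal_add ENNReal.one_ne_top (hfin hr), ENNReal.toReal_add (hfin hp) (hfin hq),
      ENNReal.toReal_one] at h
  by_cases hrt : r = ∞
  · subst hrt
    simp only [ENNReal.inv_top, ENNReal.toReal_zero, add_zero] at hsum
    obtain ⟨c, hc, hcn⟩ := FrobeniusVN.exists_toL1_eq_conv hF hp hq hsum.symm x y
    exact ⟨c, hc, by simpa [FrobeniusVN.pNorm] using hcn⟩
  -- For finite `r`, the exponents `1` and `∞` show that `x ∗ y` is bounded.
  · obtain ⟨c, hc, -⟩ := FrobeniusVN.exists_toL1_eq_conv hF (le_refl 1) (le_top (a := 1))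
      (by simp) x y
    refine ⟨c, hc, FrobeniusVN.pNorm_le_of_analyticFamily hF.trace c hr hrt fun Z hZ => ?_⟩
    rw [← FrobeniusVN.traceMul_toL1, hc]
    exact FrobeniusVN.norm_traceMul_conv_le hF.trace hF.convolution hF.antipode hp hq
      (by linarith [ENNReal.toReal_nonneg (a := r⁻¹)]) (by linarith) x y hZ
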